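/- All spaces are complex. A \emph{dual Banach algebra} $(\mathcal B,\mathcal B_*)$ is a (not necessarily unital) Banach algebra $\mathcal B$ together with a Banach space $\mathcal B_*$ and an isomorphism of Banach spaces $\mathcal B\cong(\mathcal B_*)'$ such that the multiplication of $\mathcal B$ is separately continuous for the resulting weak$^*$-topology. A \emph{W$^*$-algebra} $(\mathcal A,\mathcal A_*)$ is a C$^*$-algebra $\mathcal A$ which is a dual Banach algebra whose identification $\mathcal A\cong(\mathcal A_*)'$ is isometric. The dual $\mathcal A'$ is an $\mathcal A$-bimodule through $\langle a\cdot\mu,b\rangle=\langle\mu,ba\rangle$ and $\langle\mu\cdot a,b\rangle=\langle\mu,ab\rangle$, and $\mathcal A_*$ is regarded as a subspace of $\mathcal A'$ through the canonical map $\kappa_{\mathcal A_*}:\mathcal A_*\to(\mathcal A_*)''\cong\mathcal A'$. A \emph{module predual} of $\mathcal A$ is a closed sub-bimodule $F\subseteq\mathcal A'$ such that the natural map $\mathcal A\to F'$, $a\mapsto(\mu\mapsto\langle\mu,a\rangle)$, is an isomorphism of Banach spaces (not necessarily isometric). \textbf{Theorem.} Let $(\mathcal A,\mathcal A_*)$ be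 a commutative W$^*$-algebra. (1) Let $(\mathcal B,\mathcal B_*)$ be a dual Banach algebra and let $\theta:\mathcal A\to\mathcal B$ be a Banach algebra isomorphism, that is, a bounded bijective algebra homomorphism (not necessarily isometric). Then $\theta$ is weak$^*$-continuous, that is, continuous from the weak$^*$-topology given by $\mathcal A_*$ to the weak$^*$-topology given by $\mathcal B_*$. (2) Equivalently, the module predual of $\mathcal A$ is unique: a subspace $F\subseteq\mathcal A'$ is a module predual of $\mathcal A$ if and only if $F=\kappa_{\mathcal A_*}(\mathcal A_*)$. -/

import Mathlib

open scoped Topology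

noncomputable section

namespace DualBanach

open NormedSpace

variable {B : Type*} [NonUnitalNormedRing B] [NormedSpace ℂ B]
variable {E : Type*} [NormedAddCommGroup E] [NormedSpace ℂ E]

/-- The weak-star topology on `B` given by an identification of `B` with the dual of `E`:
the coarsest topology for which all maps `b ↦ e b x`, `x : E`, are continuous. -/
abbrev weakStar (e : B ≃L[ℂ] StrongDual ℂ E) : TopologicalSpace B :=
  TopologicalSpace.induced (fun b => StrongDual.toWeakDual (e b)) inferInstance

/-- The identification `e` of the Banach algebra `B` with the dual of the Banach space `E` makes
`(B, E)` a dual Banach algebra: the product of `B` is separately weak-star continuous. -/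
structure IsDualBanachAlgebra (e : B ≃L[ℂ] StrongDual ℂ E) : Prop where
  continuous_mul_left (b : B) : Continuous[weakStar e, weakStar e] (fun c => b * c)
  continuous_mul_right (b : B) : Continuous[weakStar e, weakStar e] (fun c => c * b)

/-- The predual `E` as a subspace of the dual of `B`: the range of the canonical map
`κ : E → E''`, where `E''` is the dual of `B` through `e`. So `x : E` becomes `b ↦ e b x`. -/
def predualInDual (e : B ≃L[ℂ] StrongDual ℂ E) : Submodule ℂ (StrongDual ℂ B) :=
  LinearMap.range
    (((ContinuousLinearMap.compL ℂ B (StrongDual ℂ E) ℂ).flip (e : B →L[ℂ] StrongDual ℂ E)).comp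
      (inclusionInDoubleDual ℂ E) : E →ₗ[ℂ] StrongDual ℂ B)

variable [IsScalarTower ℂ B B] [SMulCommClass ℂ B B]

/-- The right action on the dual of `B`: `(μ · a)(b) = μ (a * b)`. -/
def dualActRight (μ : StrongDual ℂ B) (a : B) : StrongDual ℂ B :=
  μ.comp (ContinuousLinearMap.mul ℂ B a)

/-- The left action on the dual of `B`: `(a · μ)(b) = μ (b * a)`. -/
def dualActLeft (a : B) (μ : StrongDual ℂ B) : StrongDual ℂ B :=
  μ.comp ((ContinuousLinearMap.mul ℂ B).flip a)

/-- The natural map from `B` to the dual of a subspace `F` of the dual of `B`: evaluation of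
functionals in `F`, that is, `κ : B → B''` followed by restriction to `F`. -/
def evalOn (F : Submodule ℂ (StrongDual ℂ B)) (b : B) : StrongDual ℂ F :=
  (inclusionInDoubleDual ℂ B b).comp F.subtypeL

/-- `F` is a module predual of `B`: a closed sub-bimodule of the dual of `B` such that the natural
map `B → F'` is an isomorphism. This map is linear and bounded between Banach spaces, so that
it is an isomorphism exactly when it is bijective. -/
structure IsModulePredual (F : Submodule ℂ (StrongDual ℂ B)) : Prop where
  isClosed : IsClosed (F : Set (StrongDual ℂ B))
  act_right_mem : ∀ μ ∈ F, ∀ a : B, dualActRight μ a ∈ F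
  act_left_mem : ∀ μ ∈ F, ∀ a : B, dualActLeft a μ ∈ F
  bijective : Function.Bijective (evalOn F)

end DualBanach

end

/-! Both parts say that any two preduals `P` (isometric) and `P'` of `A` coincide as subspaces of
the dual: a module predual makes `A` a dual Banach algebra, and `θ` pulls the predual of `B` back to
one of `A`. A weak-star limit of an approximate unit shows that `A` is unital, so Gelfand theory
gives `A = C(K)`. By Hahn–Banach (`predualInDual_le_of_separating`) it suffices that `P ∩ P'`
separates points.

Fix `μ ∈ P'`. The set `J` of all `c` with `μ · c ∈ P` is a closed ideal. Its bounded approximate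
unit has a `P'`-weak-star limit `q`, and `c * q = c` on `J`. If `q = 1`, then `μ b` is a limit of
values `(μ · x) b` with `μ · x ∈ P ∩ P'`, so an element killed by `P ∩ P'` is zero.

For `q = 1`, `J` must be large from the viewpoint of `P`: for positive `φ ∈ P` it contains `c` in
the unit ball with `φ (1 - c)` small (`exists_act_mem_predualInDual`). This is a Lebesgue
decomposition of `μ` against `φ` without measures: cut off the singular part
(`exists_mul_absolutelyContinuous`), then approximate the rest by multiples `φ · d`
(`exists_mem_norm_sub_le`). -/

namespace DualBanach

open Filter

/-! ### Preduals as subspaces of the dual -/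

section Predual

variable {B : Type*} [NonUnitalNormedRing B] [NormedSpace ℂ B]
variable {E : Type*} [NormedAddCommGroup E] [NormedSpace ℂ E]
variable {e : B ≃L[ℂ] StrongDual ℂ E}

theorem mem_predualInDual {μ : StrongDual ℂ B} :
    μ ∈ predualInDual e ↔ ∃ y, ∀ b, μ b = e b y := by
  constructor
  · rintro ⟨y, rfl⟩
    exact ⟨y, fun b => rfl⟩
  · rintro ⟨y, hy⟩
    exact ⟨y, by ext b; exact (hy b).symm⟩

theorem continuous_apply_weakStar (y : E) :
    Continuous[weakStar e, inferInstance] (fun b => e b y) :=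
  letI := weakStar e
  (WeakDual.eval_continuous y).comp continuous_induced_dom

theorem continuous_weakStar_iff {T : Type*} [TopologicalSpace T] {f : T → B} :
    Continuous[inferInstance, weakStar e] f ↔ ∀ y, Continuous (fun t => e (f t) y) := by
  constructor
  · intro h y
    let := weakStar e
    exact (continuous_apply_weakStar y).comp h
  · intro h
    exact continuous_induced_rng.2 (WeakDual.continuous_of_continuous_eval h)

/-- A linear functional that is weak-star continuous comes from the predual. -/
theorem exists_eq_of_continuous_weakStar (f : B →ₗ[ℂ] ℂ)
    (hf : Continuous[weakStar e, inferInstance] f) : ∃ y, ∀ b, f b = e b y := by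
  let g : E →ₗ[ℂ] (B →ₗ[ℂ] ℂ) :=
    LinearMap.mk₂ ℂ (fun y b => e b y) (by simp) (by simp) (by simp) (by simp)
  -- Functionals continuous for the initial topology of the family `g y` lie in its span, and the
  -- family is already a subspace. One inequality of topologies suffices.
  have hle : (⨅ y, TopologicalSpace.induced (g y) inferInstance) ≤ weakStar e := by
    rw [weakStar, ← continuous_iff_le_induced]
    let : TopologicalSpace B := ⨅ y, TopologicalSpace.induced (g y) inferInstance
    refine WeakDual.continuous_of_continuous_eval fun y => ?_
    exact continuous_iInf_dom (i := y) continuous_induced_dom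
  have hmem := (LinearMap.mem_span_iff_continuous (f := g) f).2
    (by exact continuous_le_dom hle hf)
  have hspan : Submodule.span ℂ (Set.range g) = LinearMap.range g := by
    rw [← LinearMap.coe_range, Submodule.span_eq]
  rw [hspan] at hmem
  obtain ⟨y, hy⟩ := hmem
  exact ⟨y, fun b => by rw [← hy]; rfl⟩

/-- Bounded families have weak-star limits along ultrafilters. -/
theorem exists_tendsto_of_bounded (e : B ≃L[ℂ] StrongDual ℂ E) {ι : Type*} (U : Ultrafilter ι)
    {f : ι → B} {r : ℝ} (hf : ∀ᶠ i in U, ‖e (f i)‖ ≤ r) :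
    ∃ b, ‖e b‖ ≤ r ∧ ∀ y, Tendsto (fun i => e (f i) y) U (𝓝 (e b y)) := by
  have hc := WeakDual.isCompact_closedBall (𝕜 := ℂ) (0 : StrongDual ℂ E) r
  obtain ⟨g, hg, hlim⟩ := hc.ultrafilter_le_nhds
    (U.map fun i => StrongDual.toWeakDual (e (f i))) (by
      rw [le_principal_iff]
      refine Filter.mem_map.2 ?_
      filter_upwards [hf] with i hi
      simpa using! hi)
  refine ⟨e.symm (WeakDual.toStrongDual g), by simpa using! hg, fun y => ?_⟩
  have h := (tendsto_iff_forall_eval_tendsto_topDualPairing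
    (f := fun i => StrongDual.toWeakDual (e (f i))) (l := (U : Filter ι)) (x := g)).1 hlim y
  simpa using! h

namespace IsDualBanachAlgebra

theorem exists_act_right [SMulCommClass ℂ B B] (he : IsDualBanachAlgebra e) (b : B) (y : E) :
    ∃ y', ∀ c, e (b * c) y = e c y' := by
  refine exists_eq_of_continuous_weakStar
    ((ContinuousLinearMap.apply ℂ ℂ y).toLinearMap ∘ₗ e.toLinearMap ∘ₗ LinearMap.mulLeft ℂ b) ?_
  let := weakStar e
  exact (continuous_apply_weakStar y).comp (he.continuous_mul_left b)

theorem exists_act_left [IsScalarTower ℂ B B] (he : IsDualBanachAlgebra e) (b : B) (y : E) :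
    ∃ y', ∀ c, e (c * b) y = e c y' := by
  refine exists_eq_of_continuous_weakStar
    ((ContinuousLinearMap.apply ℂ ℂ y).toLinearMap ∘ₗ e.toLinearMap ∘ₗ LinearMap.mulRight ℂ b) ?_
  let := weakStar e
  exact (continuous_apply_weakStar y).comp (he.continuous_mul_right b)

theorem of_exists_act (hr : ∀ b y, ∃ y', ∀ c, e (b * c) y = e c y')
    (hl : ∀ b y, ∃ y', ∀ c, e (c * b) y = e c y') : IsDualBanachAlgebra e where
  continuous_mul_left b := by
    let := weakStar e
    refine continuous_weakStar_iff.2 fun y => ?_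
    obtain ⟨y', hy'⟩ := hr b y
    simpa only [hy'] using continuous_apply_weakStar y'
  continuous_mul_right b := by
    let := weakStar e
    refine continuous_weakStar_iff.2 fun y => ?_
    obtain ⟨y', hy'⟩ := hl b y
    simpa only [hy'] using continuous_apply_weakStar y'

/-- Dual Banach algebra structures transport along isomorphisms. -/
theorem comp {C : Type*} [NonUnitalNormedRing C] [NormedSpace ℂ C]
    [IsScalarTower ℂ B B] [SMulCommClass ℂ B B] (he : IsDualBanachAlgebra e)
    (T : C ≃L[ℂ] B) (hT : ∀ a b, T (a * b) = T a * T b) :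
    IsDualBanachAlgebra (T.trans e) := by
  refine of_exists_act (fun b y => ?_) fun b y => ?_
  · obtain ⟨y', hy'⟩ := he.exists_act_right (T b) y
    exact ⟨y', fun c => by simp [hT, hy']⟩
  · obtain ⟨y', hy'⟩ := he.exists_act_left (T b) y
    exact ⟨y', fun c => by simp [hT, hy']⟩

end IsDualBanachAlgebra

theorem eq_zero_of_forall_mem_predualInDual {b : B} (h : ∀ μ ∈ predualInDual e, μ b = 0) :
    b = 0 := by
  refine e.injective (ContinuousLinearMap.ext fun y => ?_)
  rw [map_zero]
  exact h ((ContinuousLinearMap.apply ℂ ℂ y).comp (e : B →L[ℂ] StrongDual ℂ E))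
    (mem_predualInDual.2 ⟨y, fun b => rfl⟩)

/-- The canonical map is bounded below, because a norming functional of `y` is `e` of an element of
norm at most `‖e.symm‖`; with `E` complete its range is closed. -/
theorem isClosed_predualInDual [CompleteSpace E] :
    IsClosed (predualInDual e : Set (StrongDual ℂ B)) := by
  let T : E →L[ℂ] StrongDual ℂ B :=
    ((ContinuousLinearMap.compL ℂ B (StrongDual ℂ E) ℂ).flip (e : B →L[ℂ] StrongDual ℂ E)).comp
      (NormedSpace.inclusionInDoubleDual ℂ E)
  have hT : ∀ y, ‖y‖ ≤ ‖(e.symm : StrongDual ℂ E →L[ℂ] B)‖ * ‖T y‖ := by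
    intro y
    obtain ⟨g, hg, hgy⟩ := exists_dual_vector'' ℂ y
    have h1 : T y (e.symm g) = ‖y‖ := by
      change e (e.symm g) y = _
      rw [e.apply_symm_apply]
      exact hgy
    have h2 : ‖e.symm g‖ ≤ ‖(e.symm : StrongDual ℂ E →L[ℂ] B)‖ :=
      ((e.symm : StrongDual ℂ E →L[ℂ] B).le_opNorm g).trans
        (mul_le_of_le_one_right (norm_nonneg _) hg)
    calc ‖y‖ = ‖T y (e.symm g)‖ := by rw [h1]; simp
      _ ≤ ‖T y‖ * ‖e.symm g‖ := (T y).le_opNorm _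
      _ ≤ ‖T y‖ * ‖(e.symm : StrongDual ℂ E →L[ℂ] B)‖ := by gcongr
      _ = _ := mul_comm _ _
  have hanti : AntilipschitzWith ‖(e.symm : StrongDual ℂ E →L[ℂ] B)‖₊ T :=
    AddMonoidHomClass.antilipschitz_of_bound T hT
  simpa using! hanti.isClosed_range T.uniformContinuous

/-- A predual whose intersection with a closed subspace separates points lies in that subspace. -/
theorem predualInDual_le_of_separating {Q : Submodule ℂ (StrongDual ℂ B)}
    (hQ : IsClosed (Q : Set (StrongDual ℂ B)))
    (h : ∀ b, (∀ μ ∈ predualInDual e, μ ∈ Q → μ b = 0) → b = 0) :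
    predualInDual e ≤ Q := by
  let T : E →L[ℂ] StrongDual ℂ B :=
    ((ContinuousLinearMap.compL ℂ B (StrongDual ℂ E) ℂ).flip (e : B →L[ℂ] StrongDual ℂ E)).comp
      (NormedSpace.inclusionInDoubleDual ℂ E)
  let S : Submodule ℂ E := Q.comap T.toLinearMap
  have hS : IsClosed (S : Set E) := hQ.preimage T.continuous
  rintro μ ⟨y, rfl⟩
  change y ∈ S
  rw [← Submodule.Quotient.mk_eq_zero]
  refine SeparatingDual.eq_zero_of_forall_dual_eq_zero (R := ℂ) fun g => ?_
  -- A functional on `E ⧸ S` is a functional on `E` that kills `S`, hence an element of `B`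
  -- annihilated by the intersection.
  have hb : e.symm (g.comp S.mkQL) = 0 := by
    refine h _ ?_
    rintro _ ⟨z, rfl⟩ hz
    change e (e.symm (g.comp S.mkQL)) z = 0
    have hz' : S.mkQ z = 0 := (Submodule.Quotient.mk_eq_zero S).2 hz
    simp [hz']
  have := DFunLike.congr_fun (e.symm.map_eq_zero_iff.1 hb) y
  simpa using! this

variable [IsScalarTower ℂ B B] [SMulCommClass ℂ B B]

theorem IsDualBanachAlgebra.isModulePredual [CompleteSpace E] (he : IsDualBanachAlgebra e) :
    IsModulePredual (predualInDual e) where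
  isClosed := isClosed_predualInDual
  act_right_mem μ hμ a := by
    obtain ⟨y, hy⟩ := mem_predualInDual.1 hμ
    obtain ⟨y', hy'⟩ := he.exists_act_right a y
    exact mem_predualInDual.2 ⟨y', fun b => by simp [dualActRight, hy, hy']⟩
  act_left_mem μ hμ a := by
    obtain ⟨y, hy⟩ := mem_predualInDual.1 hμ
    obtain ⟨y', hy'⟩ := he.exists_act_left a y
    exact mem_predualInDual.2 ⟨y', fun b => by simp [dualActLeft, hy, hy']⟩
  bijective := by
    constructor
    · intro a b hab
      refine sub_eq_zero.1 (eq_zero_of_forall_mem_predualInDual (e := e) fun μ hμ => ?_)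
      have h : μ a = μ b := DFunLike.congr_fun hab (⟨μ, hμ⟩ : predualInDual e)
      rw [map_sub, h, sub_self]
    · intro L
      let T : E →L[ℂ] StrongDual ℂ B :=
        ((ContinuousLinearMap.compL ℂ B (StrongDual ℂ E) ℂ).flip
          (e : B →L[ℂ] StrongDual ℂ E)).comp (NormedSpace.inclusionInDoubleDual ℂ E)
      let T' : E →L[ℂ] predualInDual e := T.codRestrict _ fun y => ⟨y, rfl⟩
      refine ⟨e.symm (L.comp T'), ContinuousLinearMap.ext ?_⟩
      rintro ⟨μ, y, rfl⟩
      change e (e.symm (L.comp T')) y = L (T' y)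
      simp

set_option maxSynthPendingDepth 3 in
/-- A module predual turns the algebra into a dual Banach algebra over it. -/
theorem IsModulePredual.exists_isDualBanachAlgebra [CompleteSpace B]
    {F : Submodule ℂ (StrongDual ℂ B)} (hF : IsModulePredual F) :
    ∃ e : B ≃L[ℂ] StrongDual ℂ F, IsDualBanachAlgebra e ∧ predualInDual e = F := by
  let T : B →L[ℂ] StrongDual ℂ F :=
    ((ContinuousLinearMap.compL ℂ F (StrongDual ℂ B) ℂ).flip F.subtypeL).comp
      (NormedSpace.inclusionInDoubleDual ℂ B)
  have hT : ⇑T = evalOn F := rfl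
  let e : B ≃L[ℂ] StrongDual ℂ F := ContinuousLinearEquiv.ofBijective T
    (LinearMap.ker_eq_bot.2 (by simpa [hT] using! hF.bijective.1))
    (LinearMap.range_eq_top.2 (by simpa [hT] using! hF.bijective.2))
  have he : ∀ b (μ : F), e b μ = (μ : StrongDual ℂ B) b := fun b μ => rfl
  refine ⟨e, IsDualBanachAlgebra.of_exists_act (fun b μ => ?_) (fun b μ => ?_), ?_⟩
  · exact ⟨⟨_, hF.act_right_mem μ μ.2 b⟩, fun c => by simp [he, dualActRight]⟩
  · exact ⟨⟨_, hF.act_left_mem μ μ.2 b⟩, fun c => by simp [he, dualActLeft]⟩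
  · ext μ
    rw [mem_predualInDual]
    constructor
    · rintro ⟨y, hy⟩
      have : μ = y := by ext b; rw [hy, he]
      rw [this]
      exact y.2
    · exact fun h => ⟨⟨μ, h⟩, fun b => rfl⟩

end Predual

/-! ### Positive functionals and polar decomposition on `C(K)` -/

section ContinuousFunctions

open scoped ComplexOrder

variable {K : Type*} [TopologicalSpace K]

theorem re_le_re_of_le {φ : StrongDual ℂ C(K, ℂ)} (hφ : ∀ f, 0 ≤ f → 0 ≤ φ f) {f g : C(K, ℂ)}
    (hfg : f ≤ g) : (φ f).re ≤ (φ g).re := by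
  have h := (Complex.le_def.1 (hφ (g - f) (sub_nonneg.2 hfg))).1
  simpa using h

/-- A union bound: `(1 - k) * (1 - m) ≥ 0` gives `1 - k * m ≤ (1 - k) + (1 - m)`. -/
theorem one_sub_prod_le {φ : StrongDual ℂ C(K, ℂ)} (hφ : ∀ f, 0 ≤ f → 0 ≤ φ f) {ι : Type*}
    {k : ι → C(K, ℂ)} (hk0 : ∀ i, 0 ≤ k i) (hk1 : ∀ i, k i ≤ 1) (s : Finset ι) :
    (0 ≤ ∏ i ∈ s, k i ∧ ∏ i ∈ s, k i ≤ 1) ∧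
      (φ (1 - ∏ i ∈ s, k i)).re ≤ ∑ i ∈ s, (φ (1 - k i)).re := by
  classical
  induction s using Finset.induction_on with
  | empty => simp
  | insert i s hi ih =>
    obtain ⟨⟨h0, h1⟩, h2⟩ := ih
    rw [Finset.prod_insert hi, Finset.sum_insert hi]
    refine ⟨⟨mul_nonneg (hk0 i) h0, mul_le_one₀ (hk1 i) h0 h1⟩, ?_⟩
    have h3 : 1 - k i * ∏ j ∈ s, k j ≤ (1 - k i) + (1 - ∏ j ∈ s, k j) := by
      have := mul_nonneg (sub_nonneg.2 (hk1 i)) (sub_nonneg.2 h1)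
      rw [← sub_nonneg] at this ⊢
      convert this using 1
      ring
    refine (re_le_re_of_le hφ h3).trans ?_
    rw [map_add, Complex.add_re]
    gcongr

variable [CompactSpace K]

/-- A functional that attains its norm at `1` is positive. -/
theorem nonneg_of_apply_one_eq_norm {φ : StrongDual ℂ C(K, ℂ)} (hφ : φ 1 = ‖φ‖) {f : C(K, ℂ)}
    (hf : 0 ≤ f) : 0 ≤ φ f := by
  have hre : ∀ x, 0 ≤ (f x).re := fun x => (Complex.le_def.1 (hf x)).1
  have him : ∀ x, (f x).im = 0 := fun x => (Complex.le_def.1 (hf x)).2.symm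
  have hle : ∀ x, (f x).re ≤ ‖f‖ := fun x => (Complex.re_le_norm _).trans (f.norm_coe_le_norm x)
  set N := ‖φ‖
  set r := ‖f‖
  have hN : 0 ≤ N := norm_nonneg _
  have hr : 0 ≤ r := norm_nonneg _
  -- Test `φ` on `f + i t`, whose norm is at most `√(r ^ 2 + t ^ 2)`: the `t ^ 2` terms cancel, and
  -- a bound linear in `t` forces the imaginary part to vanish.
  have h1 : ∀ t : ℝ, (φ f).im ^ 2 + 2 * (φ f).im * t * N ≤ N ^ 2 * r ^ 2 := by
    intro t
    have hb : ‖f + (Complex.I * t) • (1 : C(K, ℂ))‖ ≤ √(r ^ 2 + t ^ 2) := by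
      refine (ContinuousMap.norm_le _ (Real.sqrt_nonneg _)).2 fun x => ?_
      rw [Complex.norm_def]
      refine Real.sqrt_le_sqrt ?_
      simp only [Complex.normSq_apply, ContinuousMap.add_apply, ContinuousMap.smul_apply,
        ContinuousMap.one_apply, smul_eq_mul, mul_one, Complex.add_re, Complex.add_im,
        Complex.mul_re, Complex.mul_im, Complex.I_re, Complex.I_im, Complex.ofReal_re,
        Complex.ofReal_im, him x]
      nlinarith [hre x, hle x]
    have h2 := (φ.le_opNorm _).trans (mul_le_mul_of_nonneg_left hb hN)
    have h3 : ‖φ (f + (Complex.I * t) • (1 : C(K, ℂ)))‖ ^ 2 ≤ N ^ 2 * (r ^ 2 + t ^ 2) := by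
      calc _ ≤ (N * √(r ^ 2 + t ^ 2)) ^ 2 := by gcongr
        _ = _ := by rw [mul_pow, Real.sq_sqrt (by positivity)]
    rw [← Complex.normSq_eq_norm_sq, map_add, map_smul, hφ] at h3
    simp only [Complex.normSq_apply, smul_eq_mul, Complex.add_re, Complex.add_im,
        Complex.mul_re, Complex.mul_im, Complex.I_re, Complex.I_im, Complex.ofReal_re,
        Complex.ofReal_im] at h3
    nlinarith [sq_nonneg (φ f).re]
  have him0 : (φ f).im = 0 := by
    rcases hN.eq_or_lt with h0 | h0
    · have h := φ.le_opNorm f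
      rw [show ‖φ‖ = 0 from h0.symm, zero_mul] at h
      rw [norm_le_zero_iff.1 h, Complex.zero_im]
    · by_contra hy
      have h := h1 ((N ^ 2 * r ^ 2 + 1) / (2 * (φ f).im * N))
      have h' : 2 * (φ f).im * ((N ^ 2 * r ^ 2 + 1) / (2 * (φ f).im * N)) * N
          = N ^ 2 * r ^ 2 + 1 := by
        field_simp
      nlinarith [sq_nonneg (φ f).im]
  have hre0 : 0 ≤ (φ f).re := by
    have hb : ‖(r : ℂ) • (1 : C(K, ℂ)) - f‖ ≤ r := by
      refine (ContinuousMap.norm_le _ hr).2 fun x => ?_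
      have : ((r : ℂ) • (1 : C(K, ℂ)) - f) x = ((r - (f x).re : ℝ) : ℂ) := by
        apply Complex.ext <;> simp [him x]
      rw [this, Complex.norm_real, Real.norm_eq_abs, abs_le]
      constructor <;> linarith [hre x, hle x]
    have h2 := ((Complex.re_le_norm _).trans (φ.le_opNorm _)).trans
      (mul_le_mul_of_nonneg_left hb hN)
    rw [map_sub, map_smul, hφ] at h2
    simp only [smul_eq_mul, Complex.sub_re, Complex.mul_re, Complex.ofReal_re,
      Complex.ofReal_im] at h2
    change r * N - 0 * 0 - (φ f).re ≤ N * r at h2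
    linarith
  exact Complex.le_def.2 ⟨hre0, him0.symm⟩

/-- The polar decomposition of a functional that attains its norm at an element `u` of the unit
ball. -/
theorem apply_eq_apply_mul_of_attains {μ : StrongDual ℂ C(K, ℂ)} {u : C(K, ℂ)} (hu : ‖u‖ ≤ 1)
    (hμ : μ u = ‖μ‖) (c : C(K, ℂ)) : μ c = μ (u * (star u * c)) := by
  -- With radius `1 / 2` the perturbed `u` stays in the unit ball, as `s + (1 - s ^ 2) / 2 = 1 - (1
  -- - s) ^ 2 / 2`; a nonzero value, rotated to be positive, would push `μ` beyond its norm.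
  have key : ∀ c : C(K, ℂ), ‖c‖ ≤ 1 / 2 → μ ((1 - u * star u) * c) = 0 := by
    intro c hc
    set z := μ ((1 - u * star u) * c) with hz
    by_contra hne
    have hpos : 0 < ‖z‖ := norm_pos_iff.2 hne
    obtain ⟨w, hw, hwz⟩ := Complex.exists_norm_eq_mul_self z
    have hb : ‖u + w • ((1 - u * star u) * c)‖ ≤ 1 := by
      refine (ContinuousMap.norm_le _ zero_le_one).2 fun x => ?_
      have hux : ‖u x‖ ≤ 1 := (u.norm_coe_le_norm x).trans hu
      have hcx : ‖c x‖ ≤ 1 / 2 := (c.norm_coe_le_norm x).trans hc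
      have h1 : ‖1 - u x * star (u x)‖ = 1 - ‖u x‖ ^ 2 := by
        have : 1 - u x * star (u x) = ((1 - ‖u x‖ ^ 2 : ℝ) : ℂ) := by
          rw [Complex.star_def, Complex.mul_conj']
          push_cast
          ring
        rw [this, Complex.norm_real, Real.norm_of_nonneg]
        nlinarith [norm_nonneg (u x)]
      calc ‖(u + w • ((1 - u * star u) * c)) x‖
          = ‖u x + w * ((1 - u x * star (u x)) * c x)‖ := by simp
        _ ≤ ‖u x‖ + ‖w * ((1 - u x * star (u x)) * c x)‖ := norm_add_le _ _
        _ = ‖u x‖ + (1 - ‖u x‖ ^ 2) * ‖c x‖ := by rw [norm_mul, norm_mul, hw, h1, one_mul]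
        _ ≤ ‖u x‖ + (1 - ‖u x‖ ^ 2) * (1 / 2) := by
          gcongr
          nlinarith [norm_nonneg (u x)]
        _ ≤ 1 := by nlinarith [sq_nonneg (1 - ‖u x‖)]
    have h2 : ‖μ (u + w • ((1 - u * star u) * c))‖ ≤ ‖μ‖ :=
      (μ.le_opNorm _).trans (mul_le_of_le_one_right (norm_nonneg _) hb)
    rw [map_add, map_smul, hμ, ← hz, smul_eq_mul, ← hwz] at h2
    rw [← Complex.ofReal_add, Complex.norm_real] at h2
    linarith [le_abs_self (‖μ‖ + ‖z‖), Real.norm_eq_abs (‖μ‖ + ‖z‖)]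
  have hc : μ ((1 - u * star u) * c) = 0 := by
    have hpos : 0 < 2 * (‖c‖ + 1) := by positivity
    have h := key (((2 * (‖c‖ + 1))⁻¹ : ℂ) • c) (by
      have : ‖((2 * (‖c‖ + 1))⁻¹ : ℂ)‖ = (2 * (‖c‖ + 1))⁻¹ := by
        rw [norm_inv]
        congr 1
        rw [show (2 * (‖c‖ + 1) : ℂ) = ((2 * (‖c‖ + 1) : ℝ) : ℂ) by push_cast; ring,
          Complex.norm_real, Real.norm_of_nonneg hpos.le]
      rw [norm_smul, this, inv_mul_le_iff₀ hpos]
      linarith)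
    rw [mul_smul_comm, map_smul, smul_eq_mul] at h
    refine (mul_eq_zero.1 h).resolve_left (inv_ne_zero ?_)
    exact_mod_cast hpos.ne'
  rw [sub_mul, one_mul, map_sub, sub_eq_zero, mul_assoc] at hc
  exact hc

/-- Isometry is essential: a norming functional of the predual vector is an element `u` of the unit
ball of `C(K)`. Then `μ · u` attains its norm at `1`, and `v = star u` recovers `μ`. -/
theorem exists_nonneg_functional {X : Type*} [NormedAddCommGroup X] [NormedSpace ℂ X]
    (e : C(K, ℂ) ≃ₗᵢ[ℂ] StrongDual ℂ X)
    (he : IsDualBanachAlgebra e.toContinuousLinearEquiv) {μ : StrongDual ℂ C(K, ℂ)}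
    (hμ : μ ∈ predualInDual e.toContinuousLinearEquiv) :
    ∃ φ ∈ predualInDual e.toContinuousLinearEquiv, (∀ f, 0 ≤ f → 0 ≤ φ f) ∧
      ∃ v, ∀ c, μ c = φ (v * c) := by
  obtain ⟨y, hy⟩ := mem_predualInDual.1 hμ
  have hy' : ∀ b, μ b = e b y := hy
  obtain ⟨g, hg, hgy⟩ := exists_dual_vector'' ℂ y
  set u := e.symm g with hu_def
  have hu : ‖u‖ ≤ 1 := by rwa [hu_def, e.symm.norm_map]
  have hnorm : ‖μ‖ ≤ ‖y‖ := by
    refine μ.opNorm_le_bound (norm_nonneg _) fun b => ?_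
    rw [hy', mul_comm]
    simpa using (e b).le_opNorm y
  have huy : μ u = ‖y‖ := by rw [hy', hu_def, e.apply_symm_apply]; exact hgy
  have hnorm' : ‖y‖ ≤ ‖μ‖ := by
    have h := (μ.le_opNorm u).trans (mul_le_of_le_one_right (norm_nonneg _) hu)
    rw [huy] at h
    simpa using h
  have hμu : μ u = ‖μ‖ := by rw [huy, le_antisymm hnorm hnorm']
  have hact : dualActRight μ u ∈ predualInDual e.toContinuousLinearEquiv := by
    obtain ⟨y', hy'⟩ := he.exists_act_right u y
    exact mem_predualInDual.2 ⟨y', fun b => by rw [← hy', ← hy]; rfl⟩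
  refine ⟨dualActRight μ u, hact, fun f hf => nonneg_of_apply_one_eq_norm ?_ hf, star u,
    fun c => apply_eq_apply_mul_of_attains hu hμu c⟩
  have hone : dualActRight μ u 1 = ‖μ‖ := by simpa [dualActRight] using hμu
  have hle : ‖dualActRight μ u‖ ≤ ‖μ‖ := by
    refine ContinuousLinearMap.opNorm_le_bound _ (norm_nonneg _) fun b => ?_
    refine (μ.le_opNorm (u * b)).trans (mul_le_mul_of_nonneg_left ?_ (norm_nonneg _))
    exact (norm_mul_le _ _).trans (mul_le_of_le_one_left (norm_nonneg _) hu)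
  have hge : ‖μ‖ ≤ ‖dualActRight μ u‖ := by
    have h := (dualActRight μ u).le_opNorm 1
    rw [hone] at h
    have h1 : ‖(1 : C(K, ℂ))‖ ≤ 1 :=
      (ContinuousMap.norm_le _ zero_le_one).2 fun x => by simp
    have h2 := h.trans (mul_le_of_le_one_right (norm_nonneg _) h1)
    simpa using h2
  rw [hone, le_antisymm hle hge]

/-! ### Approximate Radon–Nikodym and Lebesgue decomposition -/

theorem re_apply_star_mul_self_le {φ : StrongDual ℂ C(K, ℂ)} (a : C(K, ℂ)) :
    (φ (star a * a)).re ≤ ‖φ‖ * ‖a‖ ^ 2 := by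
  refine (Complex.re_le_norm _).trans ((φ.le_opNorm _).trans ?_)
  rw [CStarRing.norm_star_mul_self, sq]

/-- A functional that is, up to `ε`, absolutely continuous with respect to a positive functional
`φ` is `2 * ε`-close to every submodule containing `φ`. -/
theorem exists_mem_norm_sub_le {P : Submodule ℂ (StrongDual ℂ C(K, ℂ))}
    (hP : ∀ μ ∈ P, ∀ a, dualActRight μ a ∈ P) {φ : StrongDual ℂ C(K, ℂ)} (hφP : φ ∈ P)
    (hφ : ∀ f, 0 ≤ f → 0 ≤ φ f) (μ : StrongDual ℂ C(K, ℂ)) {ε δ : ℝ} (hε : 0 < ε) (hδ : 0 < δ)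
    (h : ∀ a, ‖a‖ ≤ 1 → (φ (star a * a)).re ≤ δ ^ 2 → ‖μ a‖ ≤ ε) :
    ∃ p ∈ P, ‖μ - p‖ ≤ 2 * ε := by
  let f : C(K, ℂ) →ₚ[ℂ] ℂ := PositiveLinearMap.mk₀ φ.toLinearMap hφ
  let j : C(K, ℂ) →ₗ[ℂ] f.GNS :=
    (UniformSpace.Completion.toComplL (𝕜 := ℂ) (E := f.PreGNS)).toLinearMap ∘ₗ
      f.toPreGNS.toLinearMap
  have hj_inner : ∀ a b, inner ℂ (j a) (j b) = φ (star a * b) := fun a b =>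
    UniformSpace.Completion.inner_coe _ _
  have hj_norm : ∀ a, ‖j a‖ ^ 2 = (φ (star a * a)).re := by
    intro a
    rw [← hj_inner, ← inner_self_eq_norm_sq (𝕜 := ℂ)]
    rfl
  have hj_le : ∀ a, ‖j a‖ ≤ √‖φ‖ * ‖a‖ := by
    intro a
    refine abs_le_of_sq_le_sq' ?_ (by positivity) |>.2
    rw [hj_norm, mul_pow, Real.sq_sqrt (norm_nonneg _)]
    exact re_apply_star_mul_self_le a
  set C : ℝ := ‖μ‖ / δ with hC
  have hC0 : 0 ≤ C := by positivity
  -- If `‖j a‖ ≤ δ * ‖a‖`, normalise `a` and apply `h`; otherwise `‖a‖` is controlled by `‖j a‖ /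
  -- δ`.
  have hbound : ∀ a, ‖μ a‖ ≤ max (ε * ‖a‖) (C * ‖j a‖) := by
    intro a
    rcases le_or_gt ‖j a‖ (δ * ‖a‖) with hja | hja
    · refine le_max_of_le_left ?_
      rcases eq_or_ne a 0 with rfl | ha
      · simp
      have hpos : 0 < ‖a‖ := norm_pos_iff.2 ha
      have hs : ‖((‖a‖⁻¹ : ℝ) : ℂ)‖ = ‖a‖⁻¹ := by
        rw [Complex.norm_real, Real.norm_of_nonneg (by positivity)]
      have h1 := h (((‖a‖⁻¹ : ℝ) : ℂ) • a)
        (by rw [norm_smul, hs, inv_mul_cancel₀ hpos.ne'])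
        (by
          rw [← hj_norm, map_smul, norm_smul, hs]
          gcongr
          rwa [inv_mul_le_iff₀ hpos, mul_comm])
      rwa [map_smul, norm_smul, hs, inv_mul_le_iff₀ hpos, mul_comm] at h1
    · refine le_max_of_le_right ?_
      calc ‖μ a‖ ≤ ‖μ‖ * ‖a‖ := μ.le_opNorm a
        _ = C * (δ * ‖a‖) := by rw [hC]; field_simp
        _ ≤ C * ‖j a‖ := by gcongr
  -- The maximum is the norm of `T a`, so Hahn–Banach extends `μ` from the range of `T` to a
  -- contraction `G`. This splits `μ` into a part of norm at most `ε` and a part that Riesz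
  -- represents by a GNS vector `w`.
  let T : C(K, ℂ) →ₗ[ℂ] C(K, ℂ) × f.GNS := ((ε : ℂ) • LinearMap.id).prod ((C : ℂ) • j)
  have hT : ∀ a, T a = ((ε : ℂ) • a, (C : ℂ) • j a) := fun a => rfl
  have hTinj : Function.Injective T := by
    intro a b hab
    have h1 : (ε : ℂ) • a = (ε : ℂ) • b := congrArg Prod.fst hab
    exact smul_right_injective _ (by exact_mod_cast hε.ne') h1
  have hTnorm : ∀ a, ‖T a‖ = max (ε * ‖a‖) (C * ‖j a‖) := by
    intro a
    rw [hT, Prod.norm_def, norm_smul, norm_smul, Complex.norm_real, Complex.norm_real,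
      Real.norm_of_nonneg hε.le, Real.norm_of_nonneg hC0]
  let E := LinearEquiv.ofInjective T hTinj
  let L : StrongDual ℂ (LinearMap.range T) :=
    (μ.toLinearMap ∘ₗ E.symm.toLinearMap).mkContinuous 1 (by
      intro x
      obtain ⟨a, rfl⟩ := E.surjective x
      rw [one_mul]
      have h1 : ‖E a‖ = ‖T a‖ := rfl
      rw [h1, hTnorm]
      simpa using hbound a)
  obtain ⟨G, hG, hGnorm⟩ := exists_extension_norm_eq (LinearMap.range T) L
  have hG1 : ‖G‖ ≤ 1 := hGnorm ▸ LinearMap.mkContinuous_norm_le _ zero_le_one _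
  have hGa : ∀ a, μ a = (ε : ℂ) * G (a, 0) + (C : ℂ) * G (0, j a) := by
    intro a
    have h1 : G (T a) = μ a := by
      have := hG (E a)
      simpa [L] using! this
    have h2 : T a = (ε : ℂ) • (a, (0 : f.GNS)) + (C : ℂ) • ((0 : C(K, ℂ)), j a) := by simp [hT]
    rw [← h1, h2, map_add, map_smul, map_smul, smul_eq_mul, smul_eq_mul]
  let w : f.GNS := (InnerProductSpace.toDual ℂ f.GNS).symm
    (G.comp (ContinuousLinearMap.inr ℂ C(K, ℂ) f.GNS))
  have hw : ∀ x, G (0, x) = inner ℂ w x := fun x => by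
    rw [InnerProductSpace.toDual_symm_apply]
    rfl
  -- Replacing `w` by `j d` within this tolerance costs at most `ε`, since `‖j a‖ ≤ √‖φ‖ * ‖a‖`; the
  -- part given by `j d` is `C • (φ · star d)`, which lies in `P`.
  have hη : 0 < ε / (C * √‖φ‖ + 1) := by positivity
  obtain ⟨d, hd⟩ : ∃ d, ‖w - j d‖ < ε / (C * √‖φ‖ + 1) := by
    obtain ⟨d, hd⟩ := (UniformSpace.Completion.denseRange_coe (α := f.PreGNS)).exists_dist_lt w hη
    exact ⟨f.ofPreGNS d, by simpa [dist_eq_norm] using! hd⟩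
  refine ⟨(C : ℂ) • dualActRight φ (star d), P.smul_mem _ (hP _ hφP _), ?_⟩
  refine ContinuousLinearMap.opNorm_le_bound _ (by positivity) fun a => ?_
  have heq : (μ - (C : ℂ) • dualActRight φ (star d)) a
      = (ε : ℂ) * G (a, 0) + (C : ℂ) * inner ℂ (w - j d) (j a) := by
    rw [inner_sub_left, ← hw, hj_inner]
    change μ a - (C : ℂ) * φ (star d * a) = _
    rw [hGa]
    ring
  rw [heq]
  have h1 : ‖G (a, 0)‖ ≤ ‖a‖ := by
    refine (G.le_opNorm _).trans ((mul_le_of_le_one_left (norm_nonneg _) hG1).trans ?_)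
    simp [Prod.norm_def]
  have h2 : C * (ε / (C * √‖φ‖ + 1) * (√‖φ‖ * ‖a‖)) ≤ ε * ‖a‖ := by
    have : C * (ε / (C * √‖φ‖ + 1) * (√‖φ‖ * ‖a‖))
        = (C * √‖φ‖ / (C * √‖φ‖ + 1)) * (ε * ‖a‖) := by ring
    rw [this]
    refine mul_le_of_le_one_left (by positivity) ?_
    rw [div_le_one (by positivity)]
    linarith
  calc ‖(ε : ℂ) * G (a, 0) + (C : ℂ) * inner ℂ (w - j d) (j a)‖
      ≤ ε * ‖G (a, 0)‖ + C * ‖inner ℂ (w - j d) (j a)‖ := by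
        refine (norm_add_le _ _).trans_eq ?_
        rw [norm_mul, norm_mul, Complex.norm_real, Complex.norm_real,
          Real.norm_of_nonneg hε.le, Real.norm_of_nonneg hC0]
    _ ≤ ε * ‖a‖ + C * (‖w - j d‖ * ‖j a‖) := by
        gcongr
        exact norm_inner_le_norm _ _
    _ ≤ ε * ‖a‖ + C * (ε / (C * √‖φ‖ + 1) * (√‖φ‖ * ‖a‖)) := by
        gcongr
        exact hj_le a
    _ ≤ 2 * ε * ‖a‖ := by linarith

theorem norm_le_one_of_nonneg_of_le_one {k : C(K, ℂ)} (h0 : 0 ≤ k) (h1 : k ≤ 1) : ‖k‖ ≤ 1 := by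
  refine (ContinuousMap.norm_le _ zero_le_one).2 fun x => ?_
  have hx0 : 0 ≤ k x := h0 x
  have hx1 : k x ≤ 1 := h1 x
  have h := Complex.norm_of_nonneg' hx0
  have h2 : (‖k x‖ : ℂ) ≤ (1 : ℝ) := by rw [h]; simpa using hx1
  exact_mod_cast h2

/-- Every function `a` is, up to an error of norm `η`, a function `a'` annihilated by some `k` with
`1 - |a|² / η² ≤ k ≤ 1`. -/
theorem exists_separating_pair (a : C(K, ℂ)) {η : ℝ} (hη : 0 < η) :
    ∃ k a' : C(K, ℂ), 0 ≤ k ∧ k ≤ 1 ∧ 1 - k ≤ ((η ^ 2)⁻¹ : ℂ) • (star a * a) ∧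
      ‖a - a'‖ ≤ η ∧ (∀ x, k x = 0 ∨ a' x = 0) ∧ ∀ x, ‖a' x‖ ≤ ‖a x‖ := by
  have hη2 : 0 < η ^ 2 := by positivity
  have hden : ∀ x, 0 < max (‖a x‖ ^ 2) (η ^ 2) := fun x => lt_max_of_lt_right hη2
  -- `k` vanishes where `|a| ≥ η`, and the cutoff `g` of `a` where `|a| ≤ η`.
  let k : C(K, ℂ) := ⟨fun x => ((max 0 (1 - ‖a x‖ ^ 2 / η ^ 2) : ℝ) : ℂ), by fun_prop⟩
  let g : C(K, ℝ) := ⟨fun x => 1 - η ^ 2 / max (‖a x‖ ^ 2) (η ^ 2), by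
    refine continuous_const.sub (continuous_const.div (by fun_prop) fun x => (hden x).ne')⟩
  have hg0 : ∀ x, 0 ≤ g x := fun x => by
    simp only [g, ContinuousMap.coe_mk, sub_nonneg]
    rw [div_le_one (hden x)]
    exact le_max_right _ _
  have hg1 : ∀ x, g x ≤ 1 := fun x => by
    simp only [g, ContinuousMap.coe_mk, sub_le_self_iff]
    have := hden x
    positivity
  let a' : C(K, ℂ) := ⟨fun x => (g x : ℂ) * a x, by fun_prop⟩
  refine ⟨k, a', fun x => ?_, fun x => ?_, fun x => ?_, ?_, fun x => ?_, fun x => ?_⟩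
  · change (0 : ℂ) ≤ ((max 0 (1 - ‖a x‖ ^ 2 / η ^ 2) : ℝ) : ℂ)
    exact_mod_cast le_max_left _ _
  · change ((max 0 (1 - ‖a x‖ ^ 2 / η ^ 2) : ℝ) : ℂ) ≤ 1
    have : max 0 (1 - ‖a x‖ ^ 2 / η ^ 2) ≤ 1 :=
      max_le zero_le_one (sub_le_self _ (by positivity))
    exact_mod_cast this
  · change 1 - ((max 0 (1 - ‖a x‖ ^ 2 / η ^ 2) : ℝ) : ℂ) ≤ ((η ^ 2)⁻¹ : ℂ) * (star (a x) * a x)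
    rw [Complex.star_def, Complex.conj_mul']
    have : 1 - max 0 (1 - ‖a x‖ ^ 2 / η ^ 2) ≤ (η ^ 2)⁻¹ * ‖a x‖ ^ 2 := by
      have := le_max_right 0 (1 - ‖a x‖ ^ 2 / η ^ 2)
      rw [inv_mul_eq_div]
      linarith
    exact_mod_cast this
  · refine (ContinuousMap.norm_le _ hη.le).2 fun x => ?_
    have h1 : (a - a') x = ((η ^ 2 / max (‖a x‖ ^ 2) (η ^ 2) : ℝ) : ℂ) * a x := by
      simp only [ContinuousMap.sub_apply, a', g, ContinuousMap.coe_mk]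
      push_cast
      ring
    have hd := hden x
    rw [h1, norm_mul, Complex.norm_real, Real.norm_of_nonneg (by positivity), div_mul_eq_mul_div,
      div_le_iff₀ hd, sq, mul_assoc]
    refine mul_le_mul_of_nonneg_left ?_ hη.le
    rcases le_total ‖a x‖ η with h | h
    · refine le_trans ?_ (le_max_right _ _)
      nlinarith
    · refine le_trans ?_ (le_max_left _ _)
      nlinarith
  · rcases le_total ‖a x‖ η with h | h
    · right
      have h2 : max (‖a x‖ ^ 2) (η ^ 2) = η ^ 2 := max_eq_right (by gcongr)
      have h3 : g x = 0 := by simp [g, h2, div_self hη2.ne']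
      simp [a', h3]
    · left
      have h2 : 1 - ‖a x‖ ^ 2 / η ^ 2 ≤ 0 := by
        rw [sub_nonpos, one_le_div hη2]
        gcongr
      simp [k, max_eq_left h2]
  · change ‖(g x : ℂ) * a x‖ ≤ ‖a x‖
    rw [norm_mul, Complex.norm_real, Real.norm_of_nonneg (hg0 x)]
    exact mul_le_of_le_one_left (norm_nonneg _) (hg1 x)

/-- Removing the singular part, up to `ε`: for every functional `μ` there is a function `k`, close
to `1` with respect to the positive functional `φ`, such that `μ · k` is, up to `ε`, absolutely
continuous with respect to `φ`. -/
theorem exists_mul_absolutelyContinuous {φ : StrongDual ℂ C(K, ℂ)}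
    (hφ : ∀ f, 0 ≤ f → 0 ≤ φ f) (μ : StrongDual ℂ C(K, ℂ)) {ε δ : ℝ} (hε : 0 < ε) (hδ : 0 < δ) :
    ∃ k, 0 ≤ k ∧ k ≤ 1 ∧ (φ (1 - k)).re ≤ δ ∧ ∃ δ' > 0, ∀ d, ‖d‖ ≤ 1 →
      (φ (star d * d)).re ≤ δ' → ‖μ (k * d)‖ ≤ ε := by
  -- `sInf S` plays the role of the norm of the singular part. A `φ`-small `a` that nearly reaches
  -- it exhausts this part, leaving almost nothing for `k * d`, which is disjoint from `a'`.
  let S : Set ℝ := {t | ∃ δ' > 0, ∀ a, ‖a‖ ≤ 1 → (φ (star a * a)).re ≤ δ' → ‖μ a‖ ≤ t}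
  have hS : ‖μ‖ ∈ S := ⟨1, one_pos, fun a ha _ =>
    (μ.le_opNorm a).trans (mul_le_of_le_one_right (norm_nonneg _) ha)⟩
  have hSbdd : BddBelow S := by
    refine ⟨0, ?_⟩
    rintro t ⟨δ', hδ', ht⟩
    exact (norm_nonneg _).trans (ht 0 (by simp) (by simpa using hδ'.le))
  obtain ⟨t, ⟨δ₁, hδ₁, ht⟩, htlt⟩ := exists_lt_of_csInf_lt ⟨_, hS⟩
    (show sInf S < sInf S + ε / 3 by linarith)
  set η : ℝ := ε / 3 / (‖μ‖ + 1) with hη_def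
  have hη : 0 < η := by positivity
  have hμη : ‖μ‖ * η ≤ ε / 3 := by
    have : ‖μ‖ * η = ‖μ‖ / (‖μ‖ + 1) * (ε / 3) := by rw [hη_def]; ring
    rw [this]
    refine mul_le_of_le_one_left (by positivity) ?_
    rw [div_le_one (by positivity)]
    linarith
  have hnot : sInf S - ε / 3 ∉ S := fun hmem => by
    have := csInf_le hSbdd hmem
    linarith
  -- Half of `δ₁` is kept for `d`; the other bound yields `φ (1 - k) ≤ δ`.
  have hδ₂ : 0 < min (δ₁ / 2) (δ * η ^ 2) := by positivity
  obtain ⟨a, ha1, haφ, haμ⟩ : ∃ a, ‖a‖ ≤ 1 ∧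
      (φ (star a * a)).re ≤ min (δ₁ / 2) (δ * η ^ 2) ∧ sInf S - ε / 3 < ‖μ a‖ := by
    by_contra! hcon
    exact hnot ⟨_, hδ₂, hcon⟩
  obtain ⟨k, a', hk0, hk1, hka, haa', hdisj, hle⟩ := exists_separating_pair a hη
  refine ⟨k, hk0, hk1, ?_, δ₁ / 2, by positivity, fun d hd hdφ => ?_⟩
  · refine (re_le_re_of_le hφ hka).trans ?_
    have h1 : ((η ^ 2 : ℂ))⁻¹ = (((η ^ 2)⁻¹ : ℝ) : ℂ) := by push_cast; rfl
    rw [map_smul, smul_eq_mul, h1, Complex.re_ofReal_mul, inv_mul_le_iff₀ (by positivity),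
      mul_comm _ δ]
    exact haφ.trans (min_le_right _ _)
  have hkn : ∀ x, ‖k x‖ ≤ 1 := fun x =>
    (k.norm_coe_le_norm x).trans (norm_le_one_of_nonneg_of_le_one hk0 hk1)
  obtain ⟨z, hz1, hz⟩ : ∃ z : ℂ, ‖z‖ = 1 ∧ ‖μ (k * d) + z * μ a'‖ = ‖μ (k * d)‖ + ‖μ a'‖ := by
    obtain ⟨v, hv1, hv⟩ := Complex.exists_norm_eq_mul_self (μ (k * d))
    obtain ⟨w, hw1, hw⟩ := Complex.exists_norm_eq_mul_self (μ a')
    have hv0 : v ≠ 0 := norm_ne_zero_iff.1 (by rw [hv1]; exact one_ne_zero)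
    refine ⟨v⁻¹ * w, by simp [hv1, hw1], ?_⟩
    have h1 : μ (k * d) + v⁻¹ * w * μ a' = v⁻¹ * ((‖μ (k * d)‖ + ‖μ a'‖ : ℝ) : ℂ) := by
      push_cast
      rw [hv, hw, mul_add, inv_mul_cancel_left₀ hv0, mul_assoc]
    rw [h1, norm_mul, norm_inv, hv1, inv_one, one_mul, Complex.norm_real,
      Real.norm_of_nonneg (by positivity)]
  -- At each point one summand vanishes, so the sum stays in the unit ball and is `φ`-small, while
  -- `z` makes the two values of `μ` add up in modulus.
  have hxle : ∀ x, ‖(k * d + z • a') x‖ ^ 2 ≤ ‖d x‖ ^ 2 + ‖a x‖ ^ 2 ∧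
      ‖(k * d + z • a') x‖ ≤ 1 := by
    intro x
    have hdx : ‖d x‖ ≤ 1 := (d.norm_coe_le_norm x).trans hd
    have hax : ‖a x‖ ≤ 1 := (a.norm_coe_le_norm x).trans ha1
    rcases hdisj x with h | h
    · have : ‖(k * d + z • a') x‖ ≤ ‖a x‖ := by
        simpa [h, hz1] using hle x
      exact ⟨(pow_le_pow_left₀ (norm_nonneg _) this 2).trans (by nlinarith [sq_nonneg ‖d x‖]),
        this.trans hax⟩
    · have : ‖(k * d + z • a') x‖ ≤ ‖d x‖ := by
        simpa [h] using mul_le_of_le_one_left (norm_nonneg (d x)) (hkn x)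
      exact ⟨(pow_le_pow_left₀ (norm_nonneg _) this 2).trans (by nlinarith [sq_nonneg ‖a x‖]),
        this.trans hdx⟩
  have hsum := ht (k * d + z • a')
    ((ContinuousMap.norm_le _ zero_le_one).2 fun x => (hxle x).2) (by
      have h1 : star (k * d + z • a') * (k * d + z • a') ≤ star d * d + star a * a := by
        intro x
        change star ((k * d + z • a') x) * (k * d + z • a') x ≤ star (d x) * d x + star (a x) * a x
        simp only [Complex.star_def, Complex.conj_mul']
        exact_mod_cast (hxle x).1
      refine (re_le_re_of_le hφ h1).trans ?_
      rw [map_add, Complex.add_re]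
      linarith [haφ.trans (min_le_left _ _)])
  rw [map_add, map_smul, smul_eq_mul, hz] at hsum
  have hdiff : ‖μ a‖ - ‖μ a'‖ ≤ ‖μ‖ * η := by
    refine (norm_sub_norm_le _ _).trans ?_
    rw [← map_sub]
    exact (μ.le_opNorm _).trans (by gcongr)
  linarith

/-! ### Multiplying functionals into the predual -/

variable {X : Type*} [NormedAddCommGroup X] [NormedSpace ℂ X] [CompleteSpace X]

/-- For every functional `μ` and every positive functional `φ` in the predual there are elements
`c` of the unit ball, as close to `1` with respect to `φ` as desired, with `μ · c` in the
predual. -/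
theorem exists_act_mem_predualInDual {e : C(K, ℂ) ≃ₗᵢ[ℂ] StrongDual ℂ X}
    (he : IsDualBanachAlgebra e.toContinuousLinearEquiv) {φ : StrongDual ℂ C(K, ℂ)}
    (hφP : φ ∈ predualInDual e.toContinuousLinearEquiv) (hφ : ∀ f, 0 ≤ f → 0 ≤ φ f)
    (μ : StrongDual ℂ C(K, ℂ)) {δ : ℝ} (hδ : 0 < δ) :
    ∃ c, ‖c‖ ≤ 1 ∧ (φ (1 - c)).re ≤ δ ∧
      dualActRight μ c ∈ predualInDual e.toContinuousLinearEquiv := by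
  have hmod := he.isModulePredual
  have step : ∀ n : ℕ, ∃ k : C(K, ℂ), 0 ≤ k ∧ k ≤ 1 ∧ (φ (1 - k)).re ≤ δ / 2 * (1 / 2) ^ n ∧
      ∃ p ∈ predualInDual e.toContinuousLinearEquiv,
        ‖dualActRight μ k - p‖ ≤ 2 * (1 / 2) ^ n := by
    intro n
    obtain ⟨k, hk0, hk1, hkφ, δ', hδ', hk⟩ := exists_mul_absolutelyContinuous hφ μ
      (ε := (1 / 2) ^ n) (δ := δ / 2 * (1 / 2) ^ n) (by positivity) (by positivity)
    refine ⟨k, hk0, hk1, hkφ, ?_⟩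
    refine exists_mem_norm_sub_le hmod.act_right_mem hφP hφ (dualActRight μ k)
      (δ := √δ') (by positivity) (Real.sqrt_pos.2 hδ') fun a ha haφ => hk a ha ?_
    rwa [Real.sq_sqrt hδ'.le] at haφ
  choose k hk0 hk1 hkφ p hpP hp using step
  have hball : ∀ s : Finset ℕ, ‖∏ i ∈ s, k i‖ ≤ 1 := fun s =>
    norm_le_one_of_nonneg_of_le_one (one_sub_prod_le hφ hk0 hk1 s).1.1
      (one_sub_prod_le hφ hk0 hk1 s).1.2
  let U : Ultrafilter ℕ := hyperfilter ℕ
  have hlim : ∀ s : ℕ → Finset ℕ, ∃ c : C(K, ℂ), ‖c‖ ≤ 1 ∧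
      ∀ ν ∈ predualInDual e.toContinuousLinearEquiv,
        Tendsto (fun N => ν (∏ i ∈ s N, k i)) U (𝓝 (ν c)) := by
    intro s
    obtain ⟨c, hc, hlim⟩ := exists_tendsto_of_bounded e.toContinuousLinearEquiv U
      (f := fun N => ∏ i ∈ s N, k i) (r := 1)
      (Eventually.of_forall fun N => by
        simpa using hball (s N))
    refine ⟨c, by simpa using hc, fun ν hν => ?_⟩
    obtain ⟨y, hy⟩ := mem_predualInDual.1 hν
    simpa only [hy] using hlim y
  obtain ⟨c, hc1, hc⟩ := hlim fun N => Finset.range N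
  -- The limit `c` of the finite products is divisible by every `k n`: take the limit with that
  -- factor omitted. Hence `μ · c = (μ · k n) · c'` is within `2 * (1 / 2) ^ n` of `p n · c'`, an
  -- element of the closed predual.
  have hfac : ∀ n, ∃ c', ‖c'‖ ≤ 1 ∧ c = k n * c' := by
    intro n
    obtain ⟨c', hc'1, hc'⟩ := hlim fun N => (Finset.range N).erase n
    refine ⟨c', hc'1, ?_⟩
    refine sub_eq_zero.1 (eq_zero_of_forall_mem_predualInDual
      (e := e.toContinuousLinearEquiv) fun ν hν => ?_)
    rw [map_sub, sub_eq_zero]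
    refine tendsto_nhds_unique (hc ν hν) ((hc' _ (hmod.act_right_mem ν hν (k n))).congr' ?_)
    have hU : ∀ᶠ N in (U : Filter ℕ), n < N :=
      (hyperfilter_le_cofinite.trans Nat.cofinite_eq_atTop.le) (eventually_gt_atTop n)
    filter_upwards [hU] with N hN
    change ν (k n * ∏ i ∈ (Finset.range N).erase n, k i) = _
    rw [Finset.mul_prod_erase _ _ (Finset.mem_range.2 hN)]
  refine ⟨c, hc1, ?_, ?_⟩
  · have h1 : Tendsto (fun N => (φ (1 - ∏ i ∈ Finset.range N, k i)).re) U
        (𝓝 (φ (1 - c)).re) := by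
      simp only [map_sub]
      exact (Complex.continuous_re.tendsto _).comp (tendsto_const_nhds.sub (hc φ hφP))
    refine le_of_tendsto h1 (Eventually.of_forall fun N => ?_)
    calc _ ≤ ∑ i ∈ Finset.range N, (φ (1 - k i)).re := (one_sub_prod_le hφ hk0 hk1 _).2
      _ ≤ ∑ i ∈ Finset.range N, δ / 2 * (1 / 2) ^ i := Finset.sum_le_sum fun i _ => hkφ i
      _ = δ / 2 * ∑ i ∈ Finset.range N, (1 / 2) ^ i := by rw [Finset.mul_sum]
      _ ≤ δ / 2 * 2 := by gcongr; exact sum_geometric_two_le N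
      _ = δ := by ring
  · choose c' hc'1 hc' using hfac
    refine hmod.isClosed.mem_of_tendsto (b := atTop) (f := fun n => dualActRight (p n) (c' n)) ?_
      (Eventually.of_forall fun n => hmod.act_right_mem _ (hpP n) _)
    rw [tendsto_iff_norm_sub_tendsto_zero]
    refine squeeze_zero (g := fun n : ℕ => 2 * (1 / 2 : ℝ) ^ n) (fun n => norm_nonneg _)
      (fun n => ?_) ?_
    · refine ContinuousLinearMap.opNorm_le_bound _ (by positivity) fun b => ?_
      have h1 : (dualActRight (p n) (c' n) - dualActRight μ c) b
          = - (dualActRight μ (k n) - p n) (c' n * b) := by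
        change p n (c' n * b) - μ (c * b) = -(μ (k n * (c' n * b)) - p n (c' n * b))
        rw [hc' n, mul_assoc]
        ring
      rw [h1, norm_neg]
      refine (ContinuousLinearMap.le_opNorm _ _).trans ?_
      refine mul_le_mul (hp n) ?_ (norm_nonneg _) (by positivity)
      exact (norm_mul_le _ _).trans (mul_le_of_le_one_left (norm_nonneg _) (hc'1 n))
    · simpa using (tendsto_pow_atTop_nhds_zero_of_lt_one (r := (1 / 2 : ℝ)) (by norm_num)
        (by norm_num)).const_mul 2

/-- Closed ideals of `C(K)` have approximate units in the unit ball. -/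
theorem exists_approximateUnit_ideal [T2Space K] {J : Ideal C(K, ℂ)}
    (hJ : IsClosed (J : Set C(K, ℂ))) :
    ∃ l : Filter C(K, ℂ), l.NeBot ∧ (∀ᶠ x in l, x ∈ J ∧ ‖x‖ ≤ 1) ∧
      ∀ c ∈ J, Tendsto (fun x => x * c) l (𝓝 c) := by
  let S : NonUnitalStarSubalgebra ℂ C(K, ℂ) :=
    { carrier := J
      add_mem' := J.add_mem
      zero_mem' := J.zero_mem
      mul_mem' := fun {a b} _ hb => J.mul_mem_left a hb
      smul_mem' := fun r a ha => by
        have h : r • a = (r • (1 : C(K, ℂ))) * a := by simp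
        rw [h]
        exact J.mul_mem_left _ ha
      -- A closed ideal consists of all functions vanishing off some open set, hence is
      -- self-adjoint.
      star_mem' := fun {a} ha => by
        rw [SetLike.mem_coe, ← ContinuousMap.idealOfSet_ofIdeal_isClosed hJ,
          ContinuousMap.mem_idealOfSet] at ha ⊢
        intro x hx
        simp [ha hx] }
  have : IsClosed (S : Set C(K, ℂ)) := hJ
  let : PartialOrder S := CStarAlgebra.spectralOrder S
  have : StarOrderedRing S := CStarAlgebra.spectralOrderedRing S
  have hl := CStarAlgebra.increasingApproximateUnit S
  have := hl.neBot
  refine ⟨(CStarAlgebra.approximateUnit S).map (Subtype.val), inferInstance, ?_, fun c hc => ?_⟩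
  · rw [eventually_map]
    filter_upwards [hl.eventually_norm] with x hx
    exact ⟨x.2, hx⟩
  · rw [tendsto_map'_iff]
    exact (continuous_subtype_val.tendsto _).comp (hl.tendsto_mul_right (⟨c, hc⟩ : S))

/-! ### Two preduals of `C(K)` coincide -/

theorem norm_apply_mul_sq_le {φ : StrongDual ℂ C(K, ℂ)} (hφ : ∀ f, 0 ≤ f → 0 ≤ φ f)
    (a b : C(K, ℂ)) : ‖φ (star a * b)‖ ^ 2 ≤ ‖φ‖ * ‖a‖ ^ 2 * (φ (star b * b)).re := by
  let f : C(K, ℂ) →ₚ[ℂ] ℂ := PositiveLinearMap.mk₀ φ.toLinearMap hφ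
  have h := norm_inner_le_norm (𝕜 := ℂ) (f.toPreGNS a) (f.toPreGNS b)
  have hn : ∀ a, ‖f.toPreGNS a‖ ^ 2 = (φ (star a * a)).re := fun a => by
    rw [← inner_self_eq_norm_sq (𝕜 := ℂ)]
    rfl
  have h2 : ‖φ (star a * b)‖ ≤ ‖f.toPreGNS a‖ * ‖f.toPreGNS b‖ := h
  calc ‖φ (star a * b)‖ ^ 2 ≤ (‖f.toPreGNS a‖ * ‖f.toPreGNS b‖) ^ 2 := by gcongr
    _ = ‖f.toPreGNS a‖ ^ 2 * ‖f.toPreGNS b‖ ^ 2 := mul_pow _ _ _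
    _ ≤ _ := by
      rw [hn b, hn a]
      refine mul_le_mul_of_nonneg_right (re_apply_star_mul_self_le a) ?_
      rw [← hn b]
      positivity

variable {Y : Type*} [NormedAddCommGroup Y] [NormedSpace ℂ Y] [CompleteSpace Y]

/-- The intersection of two preduals of `C(K)`, the first one isometric, separates points. -/
theorem eq_zero_of_forall_mem_inter [T2Space K] {e : C(K, ℂ) ≃ₗᵢ[ℂ] StrongDual ℂ X}
    (he : IsDualBanachAlgebra e.toContinuousLinearEquiv) {e' : C(K, ℂ) ≃L[ℂ] StrongDual ℂ Y}
    (he' : IsDualBanachAlgebra e') {b : C(K, ℂ)}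
    (hb : ∀ μ ∈ predualInDual e.toContinuousLinearEquiv, μ ∈ predualInDual e' → μ b = 0) :
    b = 0 := by
  have hmod := he.isModulePredual
  have hmod' := he'.isModulePredual
  refine eq_zero_of_forall_mem_predualInDual (e := e') fun μ hμ => ?_
  let R : C(K, ℂ) →L[ℂ] StrongDual ℂ C(K, ℂ) :=
    (ContinuousLinearMap.compL ℂ C(K, ℂ) C(K, ℂ) ℂ μ).comp (ContinuousLinearMap.mul ℂ C(K, ℂ))
  have hR : ∀ c, R c = dualActRight μ c := fun c => rfl
  let J : Ideal C(K, ℂ) :=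
    { carrier := {c | dualActRight μ c ∈ predualInDual e.toContinuousLinearEquiv}
      add_mem' := fun {a b} ha hb => by
        rw [Set.mem_ofPred_eq, ← hR] at ha hb ⊢
        rw [map_add]
        exact add_mem ha hb
      zero_mem' := by
        rw [Set.mem_ofPred_eq, ← hR, map_zero]
        exact zero_mem _
      smul_mem' := fun a c hc => by
        have h : dualActRight μ (a • c) = dualActRight (dualActRight μ c) a := by
          ext d
          change μ (a * c * d) = μ (c * (a * d))
          congr 1
          ring
        rw [Set.mem_ofPred_eq, h]
        exact hmod.act_right_mem _ hc a }
  have hJmem : ∀ c, c ∈ J ↔ dualActRight μ c ∈ predualInDual e.toContinuousLinearEquiv :=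
    fun c => Iff.rfl
  have hJ : IsClosed (J : Set C(K, ℂ)) := hmod.isClosed.preimage R.continuous
  obtain ⟨l, hl, hlJ, hlt⟩ := exists_approximateUnit_ideal hJ
  let U : Ultrafilter C(K, ℂ) := Ultrafilter.of l
  have hUl : (U : Filter C(K, ℂ)) ≤ l := Ultrafilter.of_le l
  obtain ⟨q, -, hq⟩ := exists_tendsto_of_bounded e' U (f := id)
    (r := ‖(e' : C(K, ℂ) →L[ℂ] StrongDual ℂ Y)‖) (by
      filter_upwards [hUl hlJ] with x hx
      exact ((e' : C(K, ℂ) →L[ℂ] StrongDual ℂ Y).le_opNorm x).trans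
        (mul_le_of_le_one_right (norm_nonneg _) hx.2))
  have hlim : ∀ ν ∈ predualInDual e', ∀ c,
      Tendsto (fun x => ν (c * x)) U (𝓝 (ν (c * q))) := by
    intro ν hν c
    obtain ⟨y, hy⟩ := mem_predualInDual.1 (hmod'.act_right_mem ν hν c)
    have hy' : ∀ x, ν (c * x) = e' x y := hy
    simpa only [hy', id] using hq y
  have hqc : ∀ c ∈ J, c * q = c := by
    intro c hc
    refine sub_eq_zero.1 (eq_zero_of_forall_mem_predualInDual (e := e') fun ν hν => ?_)
    rw [map_sub, sub_eq_zero]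
    refine tendsto_nhds_unique (hlim ν hν c) ?_
    have h1 := (ν.continuous.tendsto _).comp ((hlt c hc).mono_left hUl)
    simpa only [Function.comp_def, mul_comm] using h1
  have hq1 : 1 - q = 0 := by
    refine eq_zero_of_forall_mem_predualInDual (e := e.toContinuousLinearEquiv) fun ν hν => ?_
    obtain ⟨φ, hφP, hφ, v, hv⟩ := exists_nonneg_functional e he hν
    rw [hv, ← norm_le_zero_iff]
    set a := star (v * (1 - q)) with ha
    have hbd : ∀ δ > 0, ‖φ (v * (1 - q))‖ ^ 2 ≤ ‖φ‖ * ‖a‖ ^ 2 * (2 * δ) := by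
      intro δ hδ
      obtain ⟨c, hc1, hcφ, hcJ⟩ := exists_act_mem_predualInDual he hφP hφ μ hδ
      -- Since `c ∈ J`, `c * (1 - q) = 0`, so a factor `1 - c` can be inserted and Cauchy–Schwarz
      -- applied.
      have h1 : v * (1 - q) = star a * (1 - c) := by
        have := hqc c hcJ
        rw [ha, star_star]
        linear_combination -v * this
      -- `|1 - c|² ≤ 2 Re (1 - c)` holds because `|c| ≤ 1`; it turns smallness of `φ (1 - c)` into
      -- smallness in the GNS seminorm.
      have h2 : star (1 - c) * (1 - c) ≤ (1 - c) + star (1 - c) := by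
        intro x
        have hx : ‖c x‖ ≤ 1 := (c.norm_coe_le_norm x).trans hc1
        change star (1 - c x) * (1 - c x) ≤ (1 - c x) + star (1 - c x)
        have h3 : (1 - c x) + star (1 - c x) - star (1 - c x) * (1 - c x)
            = ((1 - ‖c x‖ ^ 2 : ℝ) : ℂ) := by
          push_cast
          rw [← Complex.conj_mul', star_sub, star_one, Complex.star_def]
          ring
        rw [← sub_nonneg, h3]
        have : 0 ≤ 1 - ‖c x‖ ^ 2 := by nlinarith [norm_nonneg (c x)]
        exact_mod_cast this
      have h4 : (φ (star (1 - c))).re = (φ (1 - c)).re := by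
        let f : C(K, ℂ) →ₚ[ℂ] ℂ := PositiveLinearMap.mk₀ φ.toLinearMap hφ
        have : φ (star (1 - c)) = star (φ (1 - c)) := map_star f (1 - c)
        rw [this]
        simp
      rw [h1]
      refine (norm_apply_mul_sq_le hφ a (1 - c)).trans ?_
      refine mul_le_mul_of_nonneg_left ?_ (by positivity)
      refine (re_le_re_of_le hφ h2).trans ?_
      rw [map_add, Complex.add_re, h4]
      linarith
    have h0 : ‖φ (v * (1 - q))‖ ^ 2 ≤ 0 := by
      refine ge_of_tendsto (x := 𝓝[>] (0 : ℝ)) (f := fun δ => ‖φ‖ * ‖a‖ ^ 2 * (2 * δ)) ?_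
        (eventually_mem_nhdsWithin.mono fun δ hδ => hbd δ hδ)
      have : Continuous fun δ : ℝ => ‖φ‖ * ‖a‖ ^ 2 * (2 * δ) := by fun_prop
      have h := this.tendsto 0
      simp only [mul_zero] at h
      exact h.mono_left nhdsWithin_le_nhds
    nlinarith [norm_nonneg (φ (v * (1 - q)))]
  have hfin := hlim μ hμ b
  rw [← sub_eq_zero.1 hq1, mul_one] at hfin
  refine tendsto_nhds_unique hfin (tendsto_const_nhds.congr' ?_)
  filter_upwards [hUl hlJ] with x hx
  have h := hb _ ((hJmem x).1 hx.1) (hmod'.act_right_mem μ hμ x)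
  change μ (x * b) = 0 at h
  rw [mul_comm, h]

theorem predualInDual_eq_of_continuousMap [T2Space K] {e : C(K, ℂ) ≃ₗᵢ[ℂ] StrongDual ℂ X}
    (he : IsDualBanachAlgebra e.toContinuousLinearEquiv) {e' : C(K, ℂ) ≃L[ℂ] StrongDual ℂ Y}
    (he' : IsDualBanachAlgebra e') :
    predualInDual e' = predualInDual e.toContinuousLinearEquiv :=
  le_antisymm
    (predualInDual_le_of_separating isClosed_predualInDual fun _ h =>
      eq_zero_of_forall_mem_inter he he' fun μ hμ hμ' => h μ hμ' hμ)
    (predualInDual_le_of_separating isClosed_predualInDual fun _ h =>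
      eq_zero_of_forall_mem_inter he he' h)

end ContinuousFunctions

/-! ### Reduction to `C(K)` and conclusion -/

/-- A C⋆-algebra that is a dual Banach algebra is unital. -/
theorem IsDualBanachAlgebra.exists_left_unit {A : Type*} [NonUnitalCStarAlgebra A]
    {X : Type*} [NormedAddCommGroup X] [NormedSpace ℂ X] {e : A ≃L[ℂ] StrongDual ℂ X}
    (he : IsDualBanachAlgebra e) : ∃ u : A, ∀ a, u * a = a := by
  let : PartialOrder A := CStarAlgebra.spectralOrder A
  have : StarOrderedRing A := CStarAlgebra.spectralOrderedRing A
  have hl := CStarAlgebra.increasingApproximateUnit A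
  have := hl.neBot
  let U : Ultrafilter A := Ultrafilter.of (CStarAlgebra.approximateUnit A)
  have hUl : (U : Filter A) ≤ CStarAlgebra.approximateUnit A := Ultrafilter.of_le _
  obtain ⟨u, -, hu⟩ := exists_tendsto_of_bounded e U (f := fun x => x)
    (r := ‖(e : A →L[ℂ] StrongDual ℂ X)‖) (by
      filter_upwards [hUl hl.eventually_norm] with x hx
      exact ((e : A →L[ℂ] StrongDual ℂ X).le_opNorm x).trans
        (mul_le_of_le_one_right (norm_nonneg _) hx))
  refine ⟨u, fun a => e.injective (ContinuousLinearMap.ext fun y => ?_)⟩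
  obtain ⟨y', hy'⟩ := he.exists_act_left a y
  -- The approximate unit times `a` tends to `u * a` weak-star and to `a` in norm.
  have h1 : Tendsto (fun x => e (x * a) y) U (𝓝 (e (u * a) y)) := by
    simpa only [hy'] using hu y'
  have h2 : Tendsto (fun x => e (x * a) y) U (𝓝 (e a y)) :=
    (((ContinuousLinearMap.apply ℂ ℂ y).comp (e : A →L[ℂ] StrongDual ℂ X)).continuous.tendsto
      _).comp ((hl.tendsto_mul_right a).mono_left hUl)
  exact tendsto_nhds_unique h1 h2

universe u

/-- A commutative C⋆-algebra with a unit is an algebra of continuous functions. -/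
theorem exists_linearIsometryEquiv_continuousMap {A : Type u} [NonUnitalCommCStarAlgebra A]
    {u : A} (hu : ∀ a, u * a = a) :
    ∃ (K : Type u) (_ : TopologicalSpace K) (_ : CompactSpace K) (_ : T2Space K)
      (T : A ≃ₗᵢ[ℂ] C(K, ℂ)), ∀ a b, T (a * b) = T a * T b := by
  let iR : NormedCommRing A :=
    { ‹NonUnitalCommCStarAlgebra A› with
      one := u
      one_mul := hu
      mul_one := fun a => (mul_comm a u).trans (hu a) }
  let iA : Algebra ℂ A := Algebra.ofModule smul_mul_assoc mul_smul_comm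
  let iN : NormedAlgebra ℂ A := { iA with norm_smul_le := norm_smul_le }
  let iC : CommCStarAlgebra A :=
    { ‹NonUnitalCommCStarAlgebra A›, iR, iN with }
  let Φ := gelfandStarTransform A
  refine ⟨WeakDual.characterSpace ℂ A, inferInstance, inferInstance, inferInstance,
    { toLinearEquiv := Φ.toAlgEquiv.toLinearEquiv
      norm_map' := fun a => ?_ }, fun a b => map_mul Φ a b⟩
  exact (gelfandTransform_isometry A).norm_map_of_map_zero (map_zero _) a

section Uniqueness

variable {A : Type*} [NonUnitalCommCStarAlgebra A]
variable {X : Type*} [NormedAddCommGroup X] [NormedSpace ℂ X] [CompleteSpace X]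
variable {Y : Type*} [NormedAddCommGroup Y] [NormedSpace ℂ Y] [CompleteSpace Y]

/-- Any two preduals of a commutative C⋆-algebra, the first one isometric, agree. -/
theorem predualInDual_eq_of_isometric {e : A ≃ₗᵢ[ℂ] StrongDual ℂ X}
    (he : IsDualBanachAlgebra e.toContinuousLinearEquiv) {e' : A ≃L[ℂ] StrongDual ℂ Y}
    (he' : IsDualBanachAlgebra e') :
    predualInDual e' = predualInDual e.toContinuousLinearEquiv := by
  obtain ⟨u, hu⟩ := he.exists_left_unit
  obtain ⟨K, _, _, _, T, hT⟩ := exists_linearIsometryEquiv_continuousMap hu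
  have hT' : ∀ a b, T.symm (a * b) = T.symm a * T.symm b := fun a b =>
    T.injective (by rw [hT]; simp)
  have h1 : IsDualBanachAlgebra (T.symm.trans e).toContinuousLinearEquiv :=
    he.comp T.symm.toContinuousLinearEquiv hT'
  have h2 := he'.comp T.symm.toContinuousLinearEquiv hT'
  have heq := predualInDual_eq_of_continuousMap h1 h2
  ext μ
  let ν : StrongDual ℂ C(K, ℂ) :=
    μ.comp (T.symm.toContinuousLinearEquiv : C(K, ℂ) →L[ℂ] A)
  have h3 := SetLike.ext_iff.1 heq ν
  rw [mem_predualInDual, mem_predualInDual] at h3 ⊢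
  refine Iff.trans ?_ (h3.trans ?_) <;> refine exists_congr fun y => ?_
  · exact ⟨fun h b => h (T.symm b), fun h b => by simpa [ν] using! h (T b)⟩
  · exact ⟨fun h b => by simpa [ν] using! h (T b), fun h b => h (T.symm b)⟩

/-- Isomorphisms from a commutative W⋆-algebra onto dual Banach algebras are weak-star
continuous. -/
theorem continuous_weakStar_of_bijective {e : A ≃ₗᵢ[ℂ] StrongDual ℂ X}
    (he : IsDualBanachAlgebra e.toContinuousLinearEquiv)
    {B : Type*} [NonUnitalNormedRing B] [NormedSpace ℂ B] [IsScalarTower ℂ B B]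
    [SMulCommClass ℂ B B] [CompleteSpace B] {eB : B ≃L[ℂ] StrongDual ℂ Y}
    (hB : IsDualBanachAlgebra eB) {θ : A →ₙₐ[ℂ] B} (hθ : Continuous θ)
    (hbij : Function.Bijective θ) :
    Continuous[weakStar e.toContinuousLinearEquiv, weakStar eB] θ := by
  let θL : A →L[ℂ] B := { toFun := θ, map_add' := map_add θ, map_smul' := map_smul θ, cont := hθ }
  let T : A ≃L[ℂ] B := ContinuousLinearEquiv.ofBijective θL
    (LinearMap.ker_eq_bot.2 hbij.1) (LinearMap.range_eq_top.2 hbij.2)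
  -- Weak-star continuity of `θ` amounts to the pulled-back predual of `B` lying in that of `A`.
  have heq := predualInDual_eq_of_isometric he (hB.comp T (map_mul θ))
  have hmem : ∀ y, ∃ x, ∀ a, eB (θ a) y = e.toContinuousLinearEquiv a x := by
    intro y
    have hy : (ContinuousLinearMap.apply ℂ ℂ y).comp (T.trans eB : A →L[ℂ] StrongDual ℂ Y) ∈
        predualInDual e.toContinuousLinearEquiv :=
      heq ▸ mem_predualInDual.2 ⟨y, fun _ => rfl⟩
    exact mem_predualInDual.1 hy
  let := weakStar e.toContinuousLinearEquiv
  refine continuous_weakStar_iff.2 fun y => ?_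
  obtain ⟨x, hx⟩ := hmem y
  simpa only [hx] using continuous_apply_weakStar (e := e.toContinuousLinearEquiv) x

/-- The module predual of a commutative W⋆-algebra is unique. -/
theorem isModulePredual_iff_eq_predualInDual {e : A ≃ₗᵢ[ℂ] StrongDual ℂ X}
    (he : IsDualBanachAlgebra e.toContinuousLinearEquiv) {F : Submodule ℂ (StrongDual ℂ A)} :
    IsModulePredual F ↔ F = predualInDual e.toContinuousLinearEquiv := by
  constructor
  · intro hF
    have : CompleteSpace F := hF.isClosed.completeSpace_coe
    obtain ⟨e', he', heq⟩ := hF.exists_isDualBanachAlgebra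
    exact heq.symm.trans (predualInDual_eq_of_isometric he he')
  · rintro rfl
    exact he.isModulePredual

end Uniqueness

end DualBanach

theorem mainTheorem3
    {A : Type*} [NonUnitalCommCStarAlgebra A]
    {X : Type*} [NormedAddCommGroup X] [NormedSpace ℂ X] [CompleteSpace X]
    (eA : A ≃ₗᵢ[ℂ] StrongDual ℂ X)
    (hA : DualBanach.IsDualBanachAlgebra eA.toContinuousLinearEquiv) :
    (∀ (B : Type*) [NonUnitalNormedRing B] [NormedSpace ℂ B] [IsScalarTower ℂ B B]
        [SMulCommClass ℂ B B] [CompleteSpace B]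
        (Y : Type*) [NormedAddCommGroup Y] [NormedSpace ℂ Y] [CompleteSpace Y]
        (eB : B ≃L[ℂ] StrongDual ℂ Y), DualBanach.IsDualBanachAlgebra eB →
        ∀ θ : A →ₙₐ[ℂ] B, Continuous θ → Function.Bijective θ →
          Continuous[DualBanach.weakStar eA.toContinuousLinearEquiv, DualBanach.weakStar eB] θ) ∧
    (∀ F : Submodule ℂ (StrongDual ℂ A),
        DualBanach.IsModulePredual F ↔
          F = DualBanach.predualInDual eA.toContinuousLinearEquiv) :=
  ⟨fun _ _ _ _ _ _ _ _ _ _ _ hB _ hθ hbij =>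
    DualBanach.continuous_weakStar_of_bijective hA hB hθ hbij,
    fun _ => DualBanach.isModulePredual_iff_eq_predualInDual hA⟩
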